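/- Let $b_n=n\sqrt{n+1}$ for $n\ge 0$ (so $b_0=0$) and $a_n=0$; these are the off-diagonal and diagonal entries of the Jacobi–Gribov matrix. Its polynomials of the first kind $P_n\in\mathbb{C}[x]$ are defined by $P_0=0$, $P_1=1$, $P_2(x)=(x-a_1)/b_1=x/\sqrt2$ and $b_{n-1}P_{n-1}+a_nP_n+b_nP_{n+1}=xP_n$ for $n\ge 2$. Let $\mathbb{B}$ be the Bargmann space of entire functions $\varphi$ with $\int_{\mathbb{C}}|\varphi(z)|^2e^{-|z|^2}\,dx\,dy<\infty$, with the scalar product $\frac1\pi\int_{\mathbb C}\overline{\varphi}\,\psi\, e^{-|z|^2}dx\,dy$, and let $\mathbb{B}_0=\{\varphi\in\mathbb{B}:\varphi(0)=0\}$. For real $\lambda\neq 0$ let $H_\lambda=i\lambda\left(z\frac{d^2}{dz^2}+z^2\frac{d}{dz}\right)$ on the polynomials that vanish at $0$, an operator in $\mathbb{B}_0$, and let $H_\lambda^{\min}$ be its closure. For a closed densely defined operator $T$, say that $T$ has deficiency indices $(p,q)$ if $\dim\ker(T^*-\bar z I)=p$ for all $z$ with $\operatorname{Im}z>0$ and $=q$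 for all $z$ with $\operatorname{Im}z<0$. Then: (i) $(P_n)_{n\ge1}$ is the canonical polynomial system of the weights $(b_n)$: $b_0=0$, $b_n>0$ for $n\ge1$, $P_1=1$, and $b_{n-1}P_{n-1}+b_nP_{n+1}=xP_n$ for all $n\ge1$. (ii) The polynomials $P_n$, $n\ge1$, have real coefficients, and $P_n(-x)=(-1)^{n-1}P_n(x)$. (iii) $b_{n-1}b_{n+1}\le b_n^2$ for all $n\ge1$. (iv) $\sum_{n=1}^\infty 1/b_n<\infty$. (v) For every real $\lambda\ne0$, $H_\lambda$ is densely defined and closable in $\mathbb{B}_0$, and $H_\lambda^{\min}$ has deficiency indices $(1,1)$. Moreover the operator $-iH_\lambda^{\min}$ is symmetric and also has deficiency indices $(1,1)$. -/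

import Mathlib

noncomputable section

namespace Gribov

open Polynomial MeasureTheory
open scoped ComplexConjugate

theorem integrable_monomial (k : ℕ) :
    Integrable (fun z : ℂ => ‖z ^ k‖ ^ 2 * Real.exp (-‖z‖ ^ 2)) := by
  have h := Complex.integral_rpow_mul_exp_neg_rpow (p := 2) (q := ((2 * k : ℕ) : ℝ)) (by norm_num)
    (by have : (0 : ℝ) ≤ ((2 * k : ℕ) : ℝ) := Nat.cast_nonneg _
        linarith)
  have h2 : Integrable (fun z : ℂ => ‖z‖ ^ ((2 * k : ℕ) : ℝ) * Real.exp (-‖z‖ ^ (2 : ℝ))) := by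
    apply Integrable.of_integral_ne_zero
    rw [h]
    have : 0 < Real.Gamma ((((2 * k : ℕ) : ℝ) + 2) / 2) := Real.Gamma_pos_of_pos (by positivity)
    positivity
  refine h2.congr (Filter.Eventually.of_forall fun z => ?_)
  simp only [Real.rpow_natCast, Real.rpow_two, norm_pow]
  rw [pow_mul, ← pow_mul, ← pow_mul, mul_comm 2 k]

/-- Entire functions that are square integrable for `e^{-|z|²} dx dy`. -/
def bargmannSubmodule : Submodule ℂ (ℂ → ℂ) where
  carrier := {φ | Differentiable ℂ φ ∧ Integrable (fun z : ℂ => ‖φ z‖ ^ 2 * Real.exp (-‖z‖ ^ 2))}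
  zero_mem' := ⟨differentiable_const 0, by simp⟩
  add_mem' := by
    rintro φ ψ ⟨hφ, iφ⟩ ⟨hψ, iψ⟩
    refine ⟨hφ.add hψ, ((iφ.const_mul 2).add (iψ.const_mul 2)).mono' ?_ ?_⟩
    · have := (hφ.add hψ).continuous
      exact Continuous.aestronglyMeasurable (by fun_prop)
    · refine Filter.Eventually.of_forall fun z => ?_
      rw [Real.norm_of_nonneg (by positivity)]
      have h1 : ‖(φ + ψ) z‖ ≤ ‖φ z‖ + ‖ψ z‖ := norm_add_le _ _
      have h2 : ‖(φ + ψ) z‖ ^ 2 ≤ 2 * ‖φ z‖ ^ 2 + 2 * ‖ψ z‖ ^ 2 := by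
        nlinarith [sq_nonneg (‖φ z‖ - ‖ψ z‖), norm_nonneg ((φ + ψ) z)]
      have := mul_le_mul_of_nonneg_right h2 (Real.exp_pos (-‖z‖ ^ 2)).le
      simp only [Pi.add_apply] at this ⊢
      linarith
  smul_mem' := by
    rintro c φ ⟨hφ, iφ⟩
    refine ⟨hφ.const_smul c, (iφ.const_mul (‖c‖ ^ 2)).congr (Filter.Eventually.of_forall fun z => ?_)⟩
    simp only [Pi.smul_apply, smul_eq_mul, norm_mul]
    ring

/-- The Bargmann space. -/
def BargmannSpace : Type := bargmannSubmodule

namespace BargmannSpace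

instance : AddCommGroup BargmannSpace := inferInstanceAs (AddCommGroup bargmannSubmodule)

instance : Module ℂ BargmannSpace := inferInstanceAs (Module ℂ bargmannSubmodule)

instance : CoeFun BargmannSpace (fun _ => ℂ → ℂ) := ⟨Subtype.val⟩

theorem ext {φ ψ : BargmannSpace} (h : ∀ z, φ z = ψ z) : φ = ψ := Subtype.ext (funext h)

theorem add_apply (φ ψ : BargmannSpace) (z : ℂ) : (φ + ψ) z = φ z + ψ z := rfl

theorem sub_apply (φ ψ : BargmannSpace) (z : ℂ) : (φ - ψ) z = φ z - ψ z := rfl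

theorem smul_apply (c : ℂ) (φ : BargmannSpace) (z : ℂ) : (c • φ) z = c * φ z := rfl

theorem zero_apply (z : ℂ) : (0 : BargmannSpace) z = 0 := rfl

theorem differentiable (φ : BargmannSpace) : Differentiable ℂ φ := φ.2.1

theorem integrable (φ : BargmannSpace) :
    Integrable (fun z : ℂ => ‖φ z‖ ^ 2 * Real.exp (-‖z‖ ^ 2)) := φ.2.2

theorem integrable_inner (φ ψ : BargmannSpace) :
    Integrable (fun z : ℂ => conj (φ z) * ψ z * (Real.exp (-‖z‖ ^ 2) : ℂ)) := by
  refine (φ.integrable.add ψ.integrable).mono' ?_ ?_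
  · have := φ.differentiable.continuous
    have := ψ.differentiable.continuous
    exact Continuous.aestronglyMeasurable (by fun_prop)
  · refine Filter.Eventually.of_forall fun z => ?_
    simp only [norm_mul, Complex.norm_real, RCLike.norm_conj, Pi.add_apply]
    rw [Real.norm_of_nonneg (Real.exp_pos _).le, ← add_mul]
    gcongr
    nlinarith [sq_nonneg (‖φ z‖ - ‖ψ z‖), sq_nonneg (‖φ z‖ + ‖ψ z‖)]

/-- The scalar product `π⁻¹ ∫ conj (φ z) ψ z e^{-|z|²} dx dy`, for which the functions
`z ^ n / √(n!)` are orthonormal. -/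
def scalarProduct (φ ψ : BargmannSpace) : ℂ :=
  (Real.pi : ℂ)⁻¹ * ∫ z : ℂ, conj (φ z) * ψ z * (Real.exp (-‖z‖ ^ 2) : ℂ)

theorem scalarProduct_self (φ : BargmannSpace) : scalarProduct φ φ =
    ((Real.pi⁻¹ * ∫ z : ℂ, ‖φ z‖ ^ 2 * Real.exp (-‖z‖ ^ 2) : ℝ) : ℂ) := by
  rw [scalarProduct, Complex.ofReal_mul, ← integral_complex_ofReal, Complex.ofReal_inv]
  congr 2
  ext z
  rw [Complex.conj_mul']
  push_cast
  ring

/-- Laws of the scalar product. -/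
@[reducible]
def core : InnerProductSpace.Core ℂ BargmannSpace where
  inner := scalarProduct
  conj_inner_symm φ ψ := by
    simp only [scalarProduct]
    rw [map_mul, ← integral_conj]
    simp only [map_mul, Complex.conj_conj, Complex.conj_ofReal, map_inv₀]
    congr 1
    exact integral_congr_ae (Filter.Eventually.of_forall fun z => by ring)
  re_inner_nonneg φ := by
    rw [scalarProduct_self, RCLike.re_eq_complex_re, Complex.ofReal_re]
    exact mul_nonneg (inv_nonneg.2 Real.pi_pos.le) (integral_nonneg fun z => by positivity)
  add_left φ ψ χ := by
    simp only [scalarProduct]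
    rw [ ← mul_add,
      ← integral_add (integrable_inner φ χ) (integrable_inner ψ χ)]
    congr 2
    ext z
    rw [add_apply, map_add]
    ring
  smul_left φ ψ c := by
    have h : (fun z : ℂ => conj ((c • φ) z) * ψ z * (Real.exp (-‖z‖ ^ 2) : ℂ)) =
        fun z : ℂ => conj c * (conj (φ z) * ψ z * (Real.exp (-‖z‖ ^ 2) : ℂ)) := by
      funext z
      rw [smul_apply, map_mul]
      ring
    simp only [scalarProduct]
    rw [h, integral_const_mul, mul_left_comm]
  definite φ h := by
    rw [scalarProduct_self, Complex.ofReal_eq_zero, mul_eq_zero,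
      or_iff_right (inv_ne_zero Real.pi_ne_zero),
      integral_eq_zero_iff_of_nonneg (fun z => by positivity) φ.integrable] at h
    have hc : Continuous (fun z : ℂ => ‖φ z‖ ^ 2 * Real.exp (-‖z‖ ^ 2)) := by
      have := φ.differentiable.continuous
      fun_prop
    have h0 := (hc.ae_eq_iff_eq volume continuous_const).1 h
    refine ext fun z => ?_
    have hz := congrFun h0 z
    have hz' : ‖φ z‖ ^ 2 * Real.exp (-‖z‖ ^ 2) = 0 := hz
    simpa [Real.exp_ne_zero, zero_apply] using hz'

instance : NormedAddCommGroup BargmannSpace := core.toNormedAddCommGroup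

instance : InnerProductSpace ℂ BargmannSpace := InnerProductSpace.ofCore core.toCore

theorem norm_sq_eq (φ : BargmannSpace) :
    ‖φ‖ ^ 2 = Real.pi⁻¹ * ∫ z : ℂ, ‖φ z‖ ^ 2 * Real.exp (-‖z‖ ^ 2) := by
  have h := inner_self_eq_norm_sq_to_K (𝕜 := ℂ) φ
  have h2 : inner ℂ φ φ = _ := scalarProduct_self φ
  rw [h] at h2
  exact Complex.ofReal_injective (by rw [Complex.ofReal_pow]; exact h2)

theorem inner_def (φ ψ : BargmannSpace) : inner ℂ φ ψ =
    (Real.pi : ℂ)⁻¹ * ∫ z : ℂ, conj (φ z) * ψ z * (Real.exp (-‖z‖ ^ 2) : ℂ) := rfl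


/-- A pointwise bound from the mean value property on the unit disc about `w`. -/
theorem pi_mul_enorm_sq_le {f : ℂ → ℂ} (hf : Differentiable ℂ f) (w : ℂ) :
    ENNReal.ofReal Real.pi * ‖f w‖ₑ ^ 2 ≤ ∫⁻ z in Metric.ball w 1, ‖f z‖ₑ ^ 2 := by
  have hcirc : ∀ r : ℝ, ENNReal.ofReal (2 * Real.pi) * ‖f w‖ₑ ^ 2 ≤
      ∫⁻ θ in Set.Ioo (-Real.pi) Real.pi, ‖f (w + r * Complex.exp (θ * Complex.I))‖ₑ ^ 2 := by
    intro r
    have h1 : Real.circleAverage (fun z => f z ^ 2) w r = f w ^ 2 := by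
      exact ((hf.pow 2).diffContOnCl).circleAverage
    have hper : Function.Periodic (fun θ : ℝ => f (circleMap w r θ) ^ 2) (2 * Real.pi) := fun θ => by
      simp only [periodic_circleMap w r θ]
    have h2 := hper.intervalIntegral_add_eq 0 (-Real.pi)
    rw [zero_add, show -Real.pi + 2 * Real.pi = Real.pi by ring] at h2
    rw [Real.circleAverage_def, h2, inv_smul_eq_iff₀ (by positivity),
      intervalIntegral.integral_of_le (by linarith [Real.pi_pos]), integral_Ioc_eq_integral_Ioo] at h1
    have h3 := enorm_integral_le_lintegral_enorm
      (μ := volume.restrict (Set.Ioo (-Real.pi) Real.pi)) (fun θ : ℝ => f (circleMap w r θ) ^ 2)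
    rw [h1, enorm_smul, enorm_pow, Real.enorm_of_nonneg (by positivity)] at h3
    simpa only [enorm_pow, circleMap] using h3
  have hpol := Complex.lintegral_comp_polarCoord_symm
    (fun z => (Metric.ball (0 : ℂ) 1).indicator (fun z => ‖f (w + z)‖ₑ ^ 2) z)
  have hball : ∫⁻ z, (Metric.ball (0 : ℂ) 1).indicator (fun z => ‖f (w + z)‖ₑ ^ 2) z =
      ∫⁻ z in Metric.ball w 1, ‖f z‖ₑ ^ 2 := by
    rw [← lintegral_indicator Metric.isOpen_ball.measurableSet,
      ← lintegral_add_left_eq_self (μ := (volume : Measure ℂ))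
        ((Metric.ball w 1).indicator fun z => ‖f z‖ₑ ^ 2) w]
    refine lintegral_congr fun z => ?_
    simp only [Set.indicator, Metric.mem_ball, dist_zero_right, dist_self_add_left]
  rw [hball] at hpol
  rw [← hpol, show polarCoord.target = Set.Ioi (0 : ℝ) ×ˢ Set.Ioo (-Real.pi) Real.pi from rfl,
    Measure.volume_eq_prod, ← Measure.prod_restrict, lintegral_prod]
  · have hint : ∫⁻ r in Set.Ioo (0 : ℝ) 1, ENNReal.ofReal r = ENNReal.ofReal (1 / 2) := by
      rw [← ofReal_integral_eq_lintegral_ofReal, ← integral_Ioc_eq_integral_Ioo,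
        ← intervalIntegral.integral_of_le zero_le_one, integral_id]
      · norm_num
      · exact (continuous_id.integrableOn_Icc).mono_set Set.Ioo_subset_Icc_self
      · exact (ae_restrict_mem measurableSet_Ioo).mono fun r hr => hr.1.le
    calc ENNReal.ofReal Real.pi * ‖f w‖ₑ ^ 2
        = ∫⁻ r in Set.Ioo (0 : ℝ) 1,
            ENNReal.ofReal r * (ENNReal.ofReal (2 * Real.pi) * ‖f w‖ₑ ^ 2) := by
          rw [lintegral_mul_const _ (by fun_prop), hint, ← mul_assoc,
            ← ENNReal.ofReal_mul (by norm_num)]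
          congr 2
          ring
      _ ≤ ∫⁻ r in Set.Ioo (0 : ℝ) 1, ∫⁻ θ in Set.Ioo (-Real.pi) Real.pi,
            ENNReal.ofReal r • (Metric.ball (0 : ℂ) 1).indicator (fun z => ‖f (w + z)‖ₑ ^ 2)
              (Complex.polarCoord.symm (r, θ)) := by
          refine setLIntegral_mono' measurableSet_Ioo fun r hr => ?_
          simp only [smul_eq_mul]
          rw [lintegral_const_mul' _ _ ENNReal.ofReal_ne_top]
          gcongr
          refine (hcirc r).trans (le_of_eq (lintegral_congr fun θ => ?_))
          rw [Set.indicator_of_mem]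
          · rw [Complex.polarCoord_symm_apply, Complex.exp_mul_I]
            push_cast
            rfl
          · rw [mem_ball_zero_iff, Complex.norm_polarCoord_symm, abs_of_pos hr.1]
            exact hr.2
      _ ≤ _ := lintegral_mono_set fun r hr => hr.1
  · have h1 : Measurable (fun z => (Metric.ball (0 : ℂ) 1).indicator (fun z => ‖f (w + z)‖ₑ ^ 2) z) := by
      refine Measurable.indicator ?_ Metric.isOpen_ball.measurableSet
      have := hf.continuous
      exact Continuous.measurable (by fun_prop)
    have h2 : Measurable (fun p : ℝ × ℝ => Complex.polarCoord.symm p) := by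
      simp only [Complex.polarCoord_symm_apply]
      fun_prop
    exact ((by fun_prop : Measurable (fun p : ℝ × ℝ => ENNReal.ofReal p.1)).smul
      (h1.comp h2)).aemeasurable

theorem norm_apply_le (φ : BargmannSpace) (w : ℂ) :
    ‖φ w‖ ≤ Real.exp ((‖w‖ + 1) ^ 2) * ‖φ‖ := by
  have h := pi_mul_enorm_sq_le φ.differentiable w
  have h2 : ∫⁻ z in Metric.ball w 1, ‖φ z‖ₑ ^ 2 ≤
      ∫⁻ z : ℂ, ENNReal.ofReal (Real.exp ((‖w‖ + 1) ^ 2)) *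
        ENNReal.ofReal (‖φ z‖ ^ 2 * Real.exp (-‖z‖ ^ 2)) := by
    refine le_trans (setLIntegral_mono' Metric.isOpen_ball.measurableSet fun z hz => ?_)
      (setLIntegral_le_lintegral _ _)
    rw [← ENNReal.ofReal_mul (Real.exp_pos _).le, ← ofReal_norm,
      ← ENNReal.ofReal_pow (norm_nonneg _)]
    apply ENNReal.ofReal_le_ofReal
    have hz1 : ‖z‖ ≤ ‖w‖ + 1 := by
      have := norm_le_norm_add_norm_sub' z w
      rw [Metric.mem_ball, dist_eq_norm] at hz
      linarith
    have h3 : 1 ≤ Real.exp ((‖w‖ + 1) ^ 2) * Real.exp (-‖z‖ ^ 2) := by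
      rw [← Real.exp_add]
      apply Real.one_le_exp
      nlinarith [norm_nonneg z]
    calc ‖φ z‖ ^ 2 = ‖φ z‖ ^ 2 * 1 := (mul_one _).symm
      _ ≤ ‖φ z‖ ^ 2 * (Real.exp ((‖w‖ + 1) ^ 2) * Real.exp (-‖z‖ ^ 2)) := by gcongr
      _ = _ := by ring
  rw [lintegral_const_mul' _ _ ENNReal.ofReal_ne_top,
    ← ofReal_integral_eq_lintegral_ofReal φ.integrable
      (Filter.Eventually.of_forall fun z => by positivity),
    ← ENNReal.ofReal_mul (Real.exp_pos _).le] at h2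
  have h4 := h.trans h2
  rw [← ofReal_norm, ← ENNReal.ofReal_pow (norm_nonneg _),
    ← ENNReal.ofReal_mul Real.pi_pos.le, ENNReal.ofReal_le_ofReal_iff (by positivity)] at h4
  have h5 := norm_sq_eq φ
  have h6 : ‖φ w‖ ^ 2 ≤ Real.exp ((‖w‖ + 1) ^ 2) * ‖φ‖ ^ 2 := by
    rw [h5, mul_left_comm, le_inv_mul_iff₀ Real.pi_pos]
    exact h4
  have h7 : 1 ≤ Real.exp ((‖w‖ + 1) ^ 2) := Real.one_le_exp (by positivity)
  refine le_of_sq_le_sq ?_ (by positivity)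
  rw [mul_pow]
  refine h6.trans ?_
  gcongr
  nlinarith

theorem memLp_weighted (φ : BargmannSpace) :
    MemLp (fun z : ℂ => φ z * (Real.exp (-‖z‖ ^ 2 / 2) : ℂ)) 2 := by
  have hm : AEStronglyMeasurable (fun z : ℂ => φ z * (Real.exp (-‖z‖ ^ 2 / 2) : ℂ)) volume := by
    have := φ.differentiable.continuous
    exact Continuous.aestronglyMeasurable (by fun_prop)
  rw [memLp_two_iff_integrable_sq_norm hm]
  refine φ.integrable.congr (Filter.Eventually.of_forall fun z => ?_)
  simp only [norm_mul, Complex.norm_real, mul_pow]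
  rw [Real.norm_of_nonneg (Real.exp_pos _).le, ← Real.exp_nat_mul]
  congr 2
  push_cast
  ring

theorem norm_weighted_sq (φ : BargmannSpace) :
    ‖(memLp_weighted φ).toLp _‖ ^ 2 = Real.pi * ‖φ‖ ^ 2 := by
  rw [norm_sq_eq, mul_inv_cancel_left₀ Real.pi_ne_zero]
  have h := inner_self_eq_norm_sq_to_K (𝕜 := ℂ) ((memLp_weighted φ).toLp _)
  rw [L2.inner_def] at h
  have h2 : ∫ z, inner ℂ ((memLp_weighted φ).toLp _ z) ((memLp_weighted φ).toLp _ z) =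
      ((∫ z : ℂ, ‖φ z‖ ^ 2 * Real.exp (-‖z‖ ^ 2) : ℝ) : ℂ) := by
    rw [← integral_complex_ofReal]
    refine integral_congr_ae ((memLp_weighted φ).coeFn_toLp.mono fun z hz => ?_)
    simp only [hz]
    rw [inner_self_eq_norm_sq_to_K (𝕜 := ℂ), norm_mul, Complex.norm_real,
      Real.norm_of_nonneg (Real.exp_pos _).le]
    rw [show Real.exp (-‖z‖ ^ 2) = Real.exp (-‖z‖ ^ 2 / 2) ^ 2 by
      rw [← Real.exp_nat_mul]; congr 1; push_cast; ring]
    simp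
    ring
  rw [h2] at h
  exact Complex.ofReal_injective (by rw [Complex.ofReal_pow]; exact h.symm)

/-- `weighted φ = φ e^{-|z|²/2}` as an element of `L²`. -/
def weighted : BargmannSpace →ₗ[ℂ] Lp ℂ 2 (volume : Measure ℂ) where
  toFun φ := (memLp_weighted φ).toLp _
  map_add' φ ψ := by
    rw [← MemLp.toLp_add]
    congr 1
    ext1 z
    simp only [add_apply, Pi.add_apply]
    ring
  map_smul' c φ := by
    rw [RingHom.id_apply, ← MemLp.toLp_const_smul]
    congr 1
    ext1 z
    simp only [smul_apply, Pi.smul_apply, smul_eq_mul]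
    ring

instance : CompleteSpace BargmannSpace := by
  have hnorm : ∀ φ : BargmannSpace, ‖weighted φ‖ = √Real.pi * ‖φ‖ := fun φ => by
    have h := norm_weighted_sq φ
    have : ‖weighted φ‖ ^ 2 = (√Real.pi * ‖φ‖) ^ 2 := by
      rw [mul_pow, Real.sq_sqrt Real.pi_pos.le]; exact h
    exact (sq_eq_sq₀ (by positivity) (by positivity)).1 this
  have hpi : 0 < √Real.pi := Real.sqrt_pos.2 Real.pi_pos
  refine Metric.complete_of_cauchySeq_tendsto fun u hu => ?_
  -- the limit in `L²`
  have hL : CauchySeq (fun n => weighted (u n)) := by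
    rw [Metric.cauchySeq_iff] at hu ⊢
    intro ε hε
    obtain ⟨N, hN⟩ := hu (ε / √Real.pi) (by positivity)
    refine ⟨N, fun m hm n hn => ?_⟩
    have := hN m hm n hn
    rw [dist_eq_norm] at this ⊢
    rw [← map_sub, hnorm]
    rwa [lt_div_iff₀' hpi] at this
  obtain ⟨F, hF⟩ := cauchySeq_tendsto_of_complete hL
  -- the locally uniform limit
  have hpt : ∀ w, CauchySeq (fun n => u n w) := fun w => by
    rw [Metric.cauchySeq_iff] at hu ⊢
    intro ε hε
    obtain ⟨N, hN⟩ := hu (ε / Real.exp ((‖w‖ + 1) ^ 2)) (by positivity)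
    refine ⟨N, fun m hm n hn => ?_⟩
    have := hN m hm n hn
    rw [dist_eq_norm, lt_div_iff₀' (Real.exp_pos _)] at this
    rw [dist_eq_norm, ← sub_apply]
    exact (norm_apply_le _ w).trans_lt this
  choose g hg using fun w => cauchySeq_tendsto_of_complete (hpt w)
  have hloc : TendstoLocallyUniformlyOn (fun n => (u n : ℂ → ℂ)) g Filter.atTop Set.univ := by
    rw [tendstoLocallyUniformlyOn_iff_forall_isCompact isOpen_univ]
    intro K _ hK
    obtain ⟨R, hR⟩ := hK.isBounded.exists_norm_le
    refine UniformCauchySeqOn.tendstoUniformlyOn_of_tendsto ?_ fun w _ => hg w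
    rw [Metric.uniformCauchySeqOn_iff]
    intro ε hε
    rw [Metric.cauchySeq_iff] at hu
    obtain ⟨N, hN⟩ := hu (ε / Real.exp ((R + 1) ^ 2)) (by positivity)
    refine ⟨N, fun m hm n hn w hw => ?_⟩
    have := hN m hm n hn
    rw [dist_eq_norm, lt_div_iff₀' (Real.exp_pos _)] at this
    rw [dist_eq_norm, ← sub_apply]
    refine (norm_apply_le _ w).trans_lt (lt_of_le_of_lt ?_ this)
    have := hR w hw
    gcongr
  have hgd : Differentiable ℂ g := by
    rw [← differentiableOn_univ]
    exact hloc.differentiableOn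
      (Filter.Eventually.of_forall fun n => (u n).differentiable.differentiableOn) isOpen_univ
  have hae : F =ᵐ[volume] fun z : ℂ => g z * (Real.exp (-‖z‖ ^ 2 / 2) : ℂ) := by
    obtain ⟨ns, hns, hlim⟩ := (tendstoInMeasure_of_tendsto_Lp hF).exists_seq_tendsto_ae
    have hall : ∀ᵐ z : ℂ, ∀ n, weighted (u n) z = u n z * (Real.exp (-‖z‖ ^ 2 / 2) : ℂ) :=
      ae_all_iff.2 fun n => (memLp_weighted (u n)).coeFn_toLp
    filter_upwards [hlim, hall] with z h1 h2
    refine tendsto_nhds_unique h1 ?_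
    simp only [h2]
    exact ((hg z).comp hns.tendsto_atTop).mul_const _
  have hgL : MemLp (fun z : ℂ => g z * (Real.exp (-‖z‖ ^ 2 / 2) : ℂ)) 2 := (memLp_congr_ae hae).1 (Lp.memLp F)
  have hgi : Integrable (fun z : ℂ => ‖g z‖ ^ 2 * Real.exp (-‖z‖ ^ 2)) := by
    refine ((memLp_two_iff_integrable_sq_norm hgL.1).1 hgL).congr
      (Filter.Eventually.of_forall fun z => ?_)
    simp only [norm_mul, Complex.norm_real, mul_pow]
    rw [Real.norm_of_nonneg (Real.exp_pos _).le, ← Real.exp_nat_mul]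
    congr 2
    push_cast
    ring
  let G : BargmannSpace := ⟨g, hgd, hgi⟩
  have hGF : weighted G = F := by
    refine Lp.ext ?_
    exact (memLp_weighted G).coeFn_toLp.trans hae.symm
  refine ⟨G, ?_⟩
  rw [tendsto_iff_norm_sub_tendsto_zero] at hF ⊢
  have h0 := hF.const_mul (√Real.pi)⁻¹
  rw [mul_zero] at h0
  refine h0.congr fun n => ?_
  rw [← hGF, ← map_sub, hnorm, inv_mul_cancel_left₀ hpi.ne']

end BargmannSpace

/-- The closed subspace of the functions that vanish at `0`. -/
def bargmannZero : Submodule ℂ BargmannSpace where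
  carrier := {φ | φ 0 = 0}
  zero_mem' := rfl
  add_mem' {φ ψ} hφ hψ := by
    have h1 : φ 0 = 0 := hφ
    have h2 : ψ 0 = 0 := hψ
    change φ 0 + ψ 0 = 0
    rw [h1, h2, add_zero]
  smul_mem' c φ hφ := by
    have h1 : φ 0 = 0 := hφ
    change c * φ 0 = 0
    rw [h1, mul_zero]

instance : CompleteSpace bargmannZero := by
  have hc : Continuous (fun φ : BargmannSpace => φ 0) := by
    refine (LipschitzWith.of_dist_le_mul (K := ⟨Real.exp ((‖(0 : ℂ)‖ + 1) ^ 2), (Real.exp_pos _).le⟩)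
      fun φ ψ => ?_).continuous
    rw [dist_eq_norm, dist_eq_norm, ← BargmannSpace.sub_apply]
    exact BargmannSpace.norm_apply_le _ _
  exact (isClosed_eq hc continuous_const : IsClosed {φ : BargmannSpace | φ 0 = 0}).completeSpace_coe

theorem polynomial_mem (p : ℂ[X]) : (fun z => p.eval z) ∈ bargmannSubmodule := by
  have h : (fun z => p.eval z) = ∑ k ∈ p.support, p.coeff k • (fun z : ℂ => z ^ k) := by
    ext z
    simp [Polynomial.eval_eq_sum, Polynomial.sum_def]
  rw [h]
  exact Submodule.sum_mem _ fun k _ => Submodule.smul_mem _ _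
    ⟨differentiable_id.pow k, integrable_monomial k⟩

/-- The polynomials that vanish at `0`. -/
def polynomialsZero : Submodule ℂ bargmannZero where
  carrier := {φ | ∃ p : ℂ[X], ∀ z, φ.1 z = p.eval z}
  zero_mem' := ⟨0, fun z => by simp [BargmannSpace.zero_apply]⟩
  add_mem' := by
    rintro φ ψ ⟨p, hp⟩ ⟨q, hq⟩
    exact ⟨p + q, fun z => by
      rw [Polynomial.eval_add, ← hp, ← hq, Submodule.coe_add, BargmannSpace.add_apply]⟩
  smul_mem' := by
    rintro c φ ⟨p, hp⟩
    exact ⟨Polynomial.C c * p, fun z => by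
      rw [Polynomial.eval_C_mul, ← hp, Submodule.coe_smul, BargmannSpace.smul_apply]⟩

/-- The differential expression `z φ'' + z² φ'`. -/
def heunExpr (φ : ℂ → ℂ) (z : ℂ) : ℂ := z * deriv (deriv φ) z + z ^ 2 * deriv φ z

theorem heunExpr_polynomial {φ : ℂ → ℂ} {p : ℂ[X]} (h : ∀ z, φ z = p.eval z) :
    heunExpr φ = fun z => (Polynomial.X * p.derivative.derivative +
      Polynomial.X ^ 2 * p.derivative).eval z := by
  obtain rfl : φ = fun z => p.eval z := funext h
  have h1 : deriv (fun z => p.eval z) = fun z => p.derivative.eval z := funext fun z => p.deriv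
  ext z
  rw [heunExpr, h1, Polynomial.deriv]
  simp

/-- The operator `z d²/dz² + z² d/dz` on the polynomials that vanish at `0`. -/
def heunOp : bargmannZero →ₗ.[ℂ] bargmannZero where
  domain := polynomialsZero
  toFun :=
    { toFun := fun φ => ⟨⟨heunExpr φ.1.1, by
          obtain ⟨p, hp⟩ := φ.2
          rw [heunExpr_polynomial hp]
          exact polynomial_mem _⟩, by
        change heunExpr φ.1.1 0 = 0
        simp [heunExpr]⟩
      map_add' := by
        rintro ⟨φ, hφ⟩ ⟨ψ, hψ⟩
        obtain ⟨p, hp⟩ := hφ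
        obtain ⟨q, hq⟩ := hψ
        refine Subtype.ext (BargmannSpace.ext fun z => ?_)
        change heunExpr (φ + ψ).1 z = heunExpr φ.1 z + heunExpr ψ.1 z
        rw [heunExpr_polynomial (p := p + q) (fun z => by
          rw [Polynomial.eval_add, ← hp, ← hq]; rfl),
          heunExpr_polynomial hp, heunExpr_polynomial hq]
        simp
        ring
      map_smul' := by
        rintro c ⟨φ, hφ⟩
        obtain ⟨p, hp⟩ := hφ
        refine Subtype.ext (BargmannSpace.ext fun z => ?_)
        change heunExpr (c • φ).1 z = c * heunExpr φ.1 z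
        rw [heunExpr_polynomial (p := Polynomial.C c * p) (fun z => by
          rw [Polynomial.eval_C_mul, ← hp]; rfl), heunExpr_polynomial hp]
        simp
        ring }

theorem heunOp_apply (φ : heunOp.domain) (z : ℂ) : (heunOp φ).1 z =
    z * deriv (deriv φ.1.1) z + z ^ 2 * deriv φ.1.1 z := rfl

/-- `H_λ = i λ (z d²/dz² + z² d/dz)` on the polynomials that vanish at `0`. -/
def gribovOp (lam : ℝ) : bargmannZero →ₗ.[ℂ] bargmannZero :=
  (Complex.I * (lam : ℂ)) • heunOp

/-- The minimal operator `H_λ^min`. -/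
def gribovMin (lam : ℝ) : bargmannZero →ₗ.[ℂ] bargmannZero := (gribovOp lam).closure

/-- `dim ker (T* - conj z)` is `p` for every `z` with positive imaginary part, and `q` for every
`z` with negative imaginary part. -/
def HasDeficiencyIndices {E : Type*} [NormedAddCommGroup E] [InnerProductSpace ℂ E]
    [CompleteSpace E] (T : E →ₗ.[ℂ] E) (p q : ℕ) : Prop :=
  (∀ z : ℂ, 0 < z.im → Module.rank ℂ
    (LinearMap.ker (T.adjoint.toFun - conj z • T.adjoint.domain.subtype)) = p) ∧
  (∀ z : ℂ, z.im < 0 → Module.rank ℂ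
    (LinearMap.ker (T.adjoint.toFun - conj z • T.adjoint.domain.subtype)) = q)

/-- The off-diagonal entries of the Jacobi-Gribov matrix; its diagonal is zero. -/
def gribovWeight (n : ℕ) : ℝ := n * √((n : ℝ) + 1)

/-- Polynomials of the first kind of the Jacobi matrix with diagonal `a` and off-diagonal `b`:
`P 1 = 1`, `P 2 = (X - a 1) / b 1`,
`b (n - 1) P (n - 1) + a n P n + b n P (n + 1) = X P n` for `n ≥ 2`, and `P 0 = 0`. -/
def firstKind (a b : ℕ → ℝ) : ℕ → ℂ[X]
  | 0 => 0
  | 1 => 1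
  | 2 => C ((b 1 : ℂ)⁻¹) * (X - C (a 1 : ℂ))
  | n + 3 => C ((b (n + 2) : ℂ)⁻¹) *
      ((X - C (a (n + 2) : ℂ)) * firstKind a b (n + 2) - C (b (n + 1) : ℂ) * firstKind a b (n + 1))

/-- `ψ 1, ψ 2, …` is the canonical polynomial system of the weights `c 1, c 2, …`. -/
structure IsCanonicalSystem (c : ℕ → ℝ) (ψ : ℕ → ℂ[X]) : Prop where
  zero : c 0 = 0
  pos : ∀ n, 1 ≤ n → 0 < c n
  one : ψ 1 = 1
  recurrence : ∀ n, 1 ≤ n →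
    C (c (n - 1) : ℂ) * ψ (n - 1) + C (c n : ℂ) * ψ (n + 1) = X * ψ n

end Gribov

end

noncomputable section

namespace Gribov

open Polynomial MeasureTheory
open scoped ComplexConjugate

/-! The normalized monomials form a Hilbert basis of the functions vanishing at `0`, and in this
basis `z d²/dz² + z² d/dz` is the real symmetric Jacobi matrix with weights `b n = gribovWeight n`
(`heunOp_basisFn`). Let `J` be this operator, let `c ≠ 0`, and let `S` extend `c • J` inside its
closure. The relation `S* φ = μ φ` can be tested on basis vectors, because it is linear and closed
on the graph; there it says that the coefficients of `φ` solve the three-term recurrence with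
spectral parameter `w = μ / conj c`. Since `b 0 = 0`, a solution is fixed by its first coefficient
and is a multiple of `P (n + 1) w`. So the kernel is at most a line, and is a line exactly when this
sequence is square summable.

Square summability holds for every complex `w`, by a Berezanskii-type argument: log-concavity of `b`
and `∑ 1 / b n < ∞` bound `√(b n) * ‖P n w‖`, hence `‖P n w‖² ≤ B² / b n` for `n ≥ 1`. No half-plane
is distinguished, so the indices are `(1, 1)` for `c = iλ` and for `c = λ`; for `c = λ` the operator
is also symmetric. The carrying lemmas are `exists_sqrt_mul_norm_le`, `eq_mul_eval_of_recurrence`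
and `IsJacobiGribov.rank_ker_adjoint_sub_smul`. -/

/-! ### Taylor coefficients as scalar products with monomials. -/

/-- On the circle of radius `r` one has `conj z = r² / z`, so this is Cauchy's formula for the
`n`-th Taylor coefficient. -/
theorem integral_conj_pow_mul_circle {f : ℂ → ℂ} (hf : Differentiable ℂ f) (n : ℕ) {r : ℝ}
    (hr : 0 < r) :
    ∫ θ in Set.Ioo (-Real.pi) Real.pi, conj (circleMap 0 r θ) ^ n * f (circleMap 0 r θ) =
      2 * Real.pi * r ^ (2 * n) * ((n.factorial : ℂ)⁻¹ * iteratedDeriv n f 0) := by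
  have hper : Function.Periodic
      (fun θ : ℝ => conj (circleMap 0 r θ) ^ n * f (circleMap 0 r θ)) (2 * Real.pi) := fun θ => by
    simp only [periodic_circleMap 0 r θ]
  have h2 := hper.intervalIntegral_add_eq 0 (-Real.pi)
  rw [zero_add, show -Real.pi + 2 * Real.pi = Real.pi by ring] at h2
  rw [← integral_Ioc_eq_integral_Ioo,
    ← intervalIntegral.integral_of_le (by linarith [Real.pi_pos]), ← h2]
  lift r to NNReal using hr.le
  have hs := hf.hasFPowerSeriesOnBall 0 (R := r) (by exact_mod_cast hr)
  have h3 := hs.factorial_smul 1 n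
  rw [← iteratedDeriv_eq_iteratedFDeriv] at h3
  have hF : (n.factorial : ℂ) ≠ 0 := by exact_mod_cast n.factorial_ne_zero
  rw [← h3, nsmul_eq_mul, inv_mul_cancel_left₀ hF, cauchyPowerSeries_apply, circleIntegral]
  have hpi : (Real.pi : ℂ) ≠ 0 := by exact_mod_cast Real.pi_ne_zero
  -- The factor `-I` cancels the `I` in `dz = i z dθ`.
  have h4 : ∀ θ : ℝ, conj (circleMap 0 r θ) ^ n * f (circleMap 0 r θ) =
      (r : ℂ) ^ (2 * n) * (-Complex.I) * (deriv (circleMap 0 r) θ • (1 / (circleMap 0 r θ - 0)) ^ n •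
        (circleMap 0 r θ - 0)⁻¹ • f (circleMap 0 r θ)) := fun θ => by
    have hz : circleMap 0 r θ ≠ 0 := circleMap_ne_center (by exact_mod_cast hr.ne')
    have hc : conj (circleMap 0 r θ) * circleMap 0 r θ = (r : ℂ) ^ 2 := by
      rw [Complex.conj_mul', norm_circleMap_zero, abs_of_nonneg hr.le]
    rw [pow_mul, ← hc, mul_pow]
    simp only [deriv_circleMap, smul_eq_mul, sub_zero, one_div, inv_pow]
    field_simp
    rw [Complex.I_sq]
    ring
  simp only [h4]
  rw [intervalIntegral.integral_const_mul]
  simp only [smul_eq_mul]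
  field_simp
  rw [Complex.I_sq]
  ring

theorem integral_radial (n : ℕ) :
    ∫ r in Set.Ioi (0 : ℝ), r ^ (2 * n + 1) * Real.exp (-r ^ 2) = n.factorial / 2 := by
  have h := integral_rpow_mul_exp_neg_rpow (p := 2) (q := ((2 * n + 1 : ℕ) : ℝ)) (by norm_num)
    (by have : (0 : ℝ) ≤ ((2 * n + 1 : ℕ) : ℝ) := Nat.cast_nonneg _
        linarith)
  simp only [Real.rpow_natCast, Real.rpow_two] at h
  rw [h, show (((2 * n + 1 : ℕ) : ℝ) + 1) / 2 = n + 1 by push_cast; ring, Real.Gamma_nat_eq_factorial]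
  ring

/-- Supplies the integrability that Fubini needs in polar coordinates. -/
theorem integrableOn_comp_polarCoord_symm {f : ℂ → ℂ} (hf : Integrable f) (hc : Continuous f) :
    IntegrableOn (fun p : ℝ × ℝ => p.1 • f (Complex.polarCoord.symm p)) polarCoord.target := by
  have hcont : Continuous (fun p : ℝ × ℝ => p.1 • f (Complex.polarCoord.symm p)) := by
    simp only [Complex.polarCoord_symm_apply]
    fun_prop
  refine ⟨hcont.aestronglyMeasurable, ?_⟩
  rw [HasFiniteIntegral]
  refine lt_of_eq_of_lt ?_ hf.2
  rw [← Complex.lintegral_comp_polarCoord_symm]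
  refine setLIntegral_congr_fun polarCoord.open_target.measurableSet fun p hp => ?_
  have hp : 0 < p.1 := hp.1
  simp only [enorm_smul, smul_eq_mul, Real.enorm_of_nonneg hp.le]

/-- The monomial `z ^ n` in the Bargmann space. -/
def monomialFn (n : ℕ) : BargmannSpace :=
  ⟨fun z => z ^ n, differentiable_id.pow n, integrable_monomial n⟩

/-- The angular integral isolates the `n`-th Taylor coefficient; the radial integral `n! / 2` then
cancels its `1 / n!`, and `2π` cancels the normalization `1 / π`. -/
theorem inner_monomialFn (n : ℕ) (φ : BargmannSpace) :
    inner ℂ (monomialFn n) φ = iteratedDeriv n φ 0 := by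
  rw [BargmannSpace.inner_def, ← Complex.integral_comp_polarCoord_symm]
  have hcφ := φ.differentiable.continuous
  have hint := integrableOn_comp_polarCoord_symm
    (BargmannSpace.integrable_inner (monomialFn n) φ) (by
      change Continuous (fun z : ℂ => conj (z ^ n) * φ z * (Real.exp (-‖z‖ ^ 2) : ℂ))
      fun_prop)
  rw [show polarCoord.target = Set.Ioi (0 : ℝ) ×ˢ Set.Ioo (-Real.pi) Real.pi from rfl] at hint ⊢
  rw [Measure.volume_eq_prod] at hint ⊢
  rw [setIntegral_prod _ hint]
  have h1 : ∀ r ∈ Set.Ioi (0 : ℝ), ∫ θ in Set.Ioo (-Real.pi) Real.pi,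
      (r, θ).1 • (conj (monomialFn n (Complex.polarCoord.symm (r, θ))) *
        φ (Complex.polarCoord.symm (r, θ)) *
          (Real.exp (-‖Complex.polarCoord.symm (r, θ)‖ ^ 2) : ℂ)) =
      ((r ^ (2 * n + 1) * Real.exp (-r ^ 2) : ℝ) : ℂ) *
        (2 * Real.pi * ((n.factorial : ℂ)⁻¹ * iteratedDeriv n φ 0)) := fun r hr => by
    have h2 : ∀ θ : ℝ, (r, θ).1 • (conj (monomialFn n (Complex.polarCoord.symm (r, θ))) *
        φ (Complex.polarCoord.symm (r, θ)) *
          (Real.exp (-‖Complex.polarCoord.symm (r, θ)‖ ^ 2) : ℂ)) =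
        ((r * Real.exp (-r ^ 2) : ℝ) : ℂ) *
          (conj (circleMap 0 r θ) ^ n * φ (circleMap 0 r θ)) := fun θ => by
      have : Complex.polarCoord.symm (r, θ) = circleMap 0 r θ := by
        rw [Complex.polarCoord_symm_apply, circleMap, Complex.exp_mul_I]
        push_cast
        ring
      rw [this, norm_circleMap_zero, sq_abs]
      change r • (conj (circleMap 0 r θ ^ n) * _ * _) = _
      rw [Complex.real_smul, map_pow]
      push_cast
      ring
    simp only [h2]
    rw [integral_const_mul, integral_conj_pow_mul_circle φ.differentiable n hr]
    push_cast
    ring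
  rw [setIntegral_congr_fun measurableSet_Ioi h1, integral_mul_const, integral_complex_ofReal,
    integral_radial]
  have hF : (n.factorial : ℂ) ≠ 0 := by exact_mod_cast n.factorial_ne_zero
  have hpi : (Real.pi : ℂ) ≠ 0 := by exact_mod_cast Real.pi_ne_zero
  push_cast
  field_simp

/-! ### The monomial basis and the Jacobi matrix. -/

/-- The normalized monomials `z ^ (n + 1) / √((n + 1)!)`. -/
def basisFn (n : ℕ) : bargmannZero :=
  ⟨((√((n + 1).factorial : ℝ) : ℂ))⁻¹ • monomialFn (n + 1), by
    change _ * (0 : ℂ) ^ (n + 1) = 0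
    simp⟩

theorem basisFn_apply (n : ℕ) (z : ℂ) :
    (basisFn n).1 z = ((√((n + 1).factorial : ℝ) : ℂ))⁻¹ * z ^ (n + 1) := rfl

theorem sqrt_factorial_ne_zero (n : ℕ) : ((√(n.factorial : ℝ) : ℝ) : ℂ) ≠ 0 := by
  have : (0 : ℝ) < n.factorial := by exact_mod_cast n.factorial_pos
  exact_mod_cast (Real.sqrt_pos.2 this).ne'

theorem inner_basisFn (n : ℕ) (φ : bargmannZero) : inner ℂ (basisFn n) φ =
    ((√((n + 1).factorial : ℝ) : ℂ))⁻¹ * iteratedDeriv (n + 1) φ.1 0 := by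
  rw [Submodule.coe_inner, basisFn, inner_smul_left, inner_monomialFn, map_inv₀, Complex.conj_ofReal]

theorem orthonormal_basisFn : Orthonormal ℂ basisFn := by
  rw [orthonormal_iff_ite]
  intro i j
  rw [inner_basisFn]
  have h : ((basisFn j).1 : ℂ → ℂ) =
      fun z => ((√((j + 1).factorial : ℝ) : ℂ))⁻¹ * z ^ (j + 1) := rfl
  rw [h, iteratedDeriv_const_mul_field, iteratedDeriv_fun_pow_zero]
  by_cases hij : i = j
  · subst hij
    have h0 := sqrt_factorial_ne_zero (i + 1)
    have h1 : (((i + 1).factorial : ℕ) : ℂ) = (√((i + 1).factorial : ℝ) : ℂ) ^ 2 := by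
      rw [← Complex.ofReal_pow, Real.sq_sqrt (Nat.cast_nonneg _)]
      simp
    simp only [if_true]
    rw [h1]
    field_simp
  · simp [hij]

/-- Orthogonality kills every Taylor coefficient of positive order, membership in `bargmannZero`
kills the constant one, and an entire function equals its Taylor series. -/
theorem orthogonal_span_basisFn : (Submodule.span ℂ (Set.range basisFn))ᗮ = ⊥ := by
  rw [Submodule.eq_bot_iff]
  intro φ hφ
  have h : ∀ n, iteratedDeriv n φ.1 0 = 0 := by
    rintro (_ | n)
    · exact φ.2
    · have := (Submodule.mem_orthogonal _ _).1 hφ _ (Submodule.subset_span ⟨n, rfl⟩)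
      rw [inner_basisFn] at this
      exact (mul_eq_zero.1 this).resolve_left (inv_ne_zero (sqrt_factorial_ne_zero _))
  refine Subtype.ext (BargmannSpace.ext fun z => ?_)
  rw [← Complex.taylorSeries_eq_of_entire' 0 z φ.1.differentiable]
  simp only [h, mul_zero, zero_mul, tsum_zero]
  rfl

/-- The Hilbert basis of normalized monomials. -/
def monomialBasis : HilbertBasis ℕ ℂ bargmannZero :=
  HilbertBasis.mkOfOrthogonalEqBot orthonormal_basisFn orthogonal_span_basisFn

theorem monomialBasis_apply (n : ℕ) : monomialBasis n = basisFn n := by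
  rw [monomialBasis, HilbertBasis.coe_mkOfOrthogonalEqBot]

theorem polynomialsZero_eq_span : polynomialsZero = Submodule.span ℂ (Set.range basisFn) := by
  refine le_antisymm ?_ (Submodule.span_le.2 ?_)
  · rintro φ ⟨p, hp⟩
    have h0 : p.coeff 0 = 0 := by
      rw [Polynomial.coeff_zero_eq_eval_zero, ← hp]
      exact φ.2
    have h : φ = ∑ k ∈ Finset.range p.natDegree,
        (p.coeff (k + 1) * (√((k + 1).factorial : ℝ) : ℂ)) • basisFn k := by
      have hev : ∀ (s : Finset ℕ) (c : ℕ → ℂ) (z : ℂ),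
          (∑ k ∈ s, c k • basisFn k : bargmannZero).1 z = ∑ k ∈ s, c k * (basisFn k).1 z := by
        intro s c z
        induction s using Finset.cons_induction with
        | empty => rfl
        | cons a s ha ih => rw [Finset.sum_cons, Finset.sum_cons, ← ih]; rfl
      refine Subtype.ext (BargmannSpace.ext fun z => ?_)
      rw [hp, hev, Polynomial.eval_eq_sum_range, Finset.sum_range_succ', h0, zero_mul, add_zero]
      refine Finset.sum_congr rfl fun k _ => ?_
      rw [basisFn_apply, mul_assoc, mul_inv_cancel_left₀ (sqrt_factorial_ne_zero _)]
    rw [h]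
    exact Submodule.sum_mem _ fun k _ => Submodule.smul_mem _ _ (Submodule.subset_span ⟨k, rfl⟩)
  · rintro _ ⟨n, rfl⟩
    exact ⟨C ((√((n + 1).factorial : ℝ) : ℂ))⁻¹ * X ^ (n + 1), fun z => by
      rw [basisFn_apply]
      simp only [eval_mul, eval_C, eval_pow, eval_X]⟩

theorem basisFn_mem_domain (n : ℕ) : basisFn n ∈ heunOp.domain := by
  change basisFn n ∈ polynomialsZero
  rw [polynomialsZero_eq_span]
  exact Submodule.subset_span ⟨n, rfl⟩

/-- Basis indices start at `0`, so `basisFn n` has degree `n + 1`. For `n = 0` the truncated `n - 1`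
is harmless because its weight vanishes. -/
theorem heunOp_basisFn (n : ℕ) : heunOp ⟨basisFn n, basisFn_mem_domain n⟩ =
    (gribovWeight n : ℂ) • basisFn (n - 1) + (gribovWeight (n + 1) : ℂ) • basisFn (n + 1) := by
  refine Subtype.ext (BargmannSpace.ext fun z => ?_)
  change heunExpr (basisFn n).1 z = (gribovWeight n : ℂ) * (basisFn (n - 1)).1 z +
    (gribovWeight (n + 1) : ℂ) * (basisFn (n + 1)).1 z
  rw [heunExpr_polynomial
    (p := C ((√((n + 1).factorial : ℝ) : ℂ))⁻¹ * X ^ (n + 1)) (fun z => by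
      rw [basisFn_apply]; simp only [eval_mul, eval_C, eval_pow, eval_X])]
  have hs : ∀ m : ℕ, (√((m + 1).factorial : ℝ) : ℂ) =
      (√((m : ℝ) + 1) : ℂ) * (√(m.factorial : ℝ) : ℂ) := fun m => by
    rw [← Complex.ofReal_mul, ← Real.sqrt_mul (by positivity), Nat.factorial_succ]
    push_cast
    rfl
  have hq : ∀ m : ℕ, ((√((m : ℝ) + 1) : ℝ) : ℂ) ≠ 0 := fun m => by
    have : (0 : ℝ) < m + 1 := by positivity
    exact_mod_cast (Real.sqrt_pos.2 this).ne'
  have hq2 : ∀ m : ℕ, ((√((m : ℝ) + 1) : ℝ) : ℂ) ^ 2 = m + 1 := fun m => by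
    rw [← Complex.ofReal_pow, Real.sq_sqrt (by positivity)]
    push_cast
    rfl
  have hf := sqrt_factorial_ne_zero
  simp only [basisFn_apply, gribovWeight]
  rcases n with _ | m
  · simp [Nat.factorial]
    have := hq 1
    norm_num at this ⊢
  · simp only [Nat.add_sub_cancel, derivative_mul, derivative_C, zero_mul, zero_add, eval_add, eval_mul,
      eval_X, eval_pow, eval_C, derivative_X_pow, Nat.cast_add, Nat.cast_one,
      Complex.ofReal_add, Complex.ofReal_mul, Complex.ofReal_natCast, Complex.ofReal_one]
    have a1 := hs (m + 1 + 1)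
    have a2 := hs (m + 1)
    push_cast at a1 a2
    rw [a1, a2]
    have b0 := hf (m + 1)
    have b1 := hq (m + 1)
    have b2 := hq (m + 1 + 1)
    have c1 := hq2 (m + 1)
    push_cast at b1 b2 c1
    field_simp
    -- Only the lowering term needs `√(m + 2) ^ 2 = m + 2`; the raising terms already agree.
    linear_combination (-(z ^ (m + 1) * (m + 1))) * c1

/-! ### Square summability of solutions of the recurrence. -/

/-- The square root of the weights times a solution of the recurrence is bounded if the weights
are log-concave with summable inverses. -/
theorem exists_sqrt_mul_norm_le {b : ℕ → ℝ} {u : ℕ → ℂ} {w : ℂ} {K : ℝ} (h0 : b 0 = 0)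
    (hpos : ∀ n, 0 < b (n + 1)) (hlog : ∀ n, b n * b (n + 2) ≤ b (n + 1) ^ 2)
    (hK : ∀ n, b (n + 2) ≤ K * b (n + 1)) (hsum : Summable fun n => 1 / b (n + 1))
    (hu : ∀ n, (b n : ℂ) * u n + (b (n + 1) : ℂ) * u (n + 2) = w * u (n + 1)) :
    ∃ B, ∀ n, √(b n) * ‖u n‖ ≤ B := by
  have hb : ∀ n, 0 ≤ b n := fun n => by
    rcases n with _ | n
    · exact h0.ge
    · exact (hpos n).le
  set C := ‖w‖ * √K with hC
  have hC0 : 0 ≤ C := by positivity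
  -- With `v n = √(b n) * ‖u n‖`, log-concavity makes the coefficient of `v n` at most `1`, and `hK`
  -- turns the spectral term into the summable perturbation `C / b (n + 1)`.
  have step : ∀ n, √(b (n + 2)) * ‖u (n + 2)‖ ≤
      C / b (n + 1) * (√(b (n + 1)) * ‖u (n + 1)‖) + √(b n) * ‖u n‖ := fun n => by
    have h1 : b (n + 1) * ‖u (n + 2)‖ ≤ ‖w‖ * ‖u (n + 1)‖ + b n * ‖u n‖ := by
      have h2 : (b (n + 1) : ℂ) * u (n + 2) = w * u (n + 1) - (b n : ℂ) * u n := by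
        rw [← hu n]; ring
      have h3 := norm_sub_le (w * u (n + 1)) ((b n : ℂ) * u n)
      rw [← h2, norm_mul, norm_mul, norm_mul, Complex.norm_of_nonneg (hb _),
        Complex.norm_of_nonneg (hb _)] at h3
      exact h3
    have h4 : √(b (n + 2)) ≤ √K * √(b (n + 1)) := by
      rw [← Real.sqrt_mul' _ (hb _)]
      exact Real.sqrt_le_sqrt (hK n)
    have h5 : √(b (n + 2)) * √(b n) ≤ b (n + 1) := by
      rw [← Real.sqrt_mul (hb _), mul_comm]
      exact Real.sqrt_le_iff.2 ⟨hb _, hlog n⟩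
    have h6 : b n = √(b n) * √(b n) := (Real.mul_self_sqrt (hb n)).symm
    have hp := hpos n
    rw [← mul_le_mul_iff_right₀ hp]
    calc b (n + 1) * (√(b (n + 2)) * ‖u (n + 2)‖)
        = √(b (n + 2)) * (b (n + 1) * ‖u (n + 2)‖) := by ring
      _ ≤ √(b (n + 2)) * (‖w‖ * ‖u (n + 1)‖ + b n * ‖u n‖) := by gcongr
      _ = √(b (n + 2)) * (‖w‖ * ‖u (n + 1)‖) +
            (√(b (n + 2)) * √(b n)) * (√(b n) * ‖u n‖) := by
          nth_rewrite 1 [h6]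
          ring
      _ ≤ (√K * √(b (n + 1))) * (‖w‖ * ‖u (n + 1)‖) + b (n + 1) * (√(b n) * ‖u n‖) := by gcongr
      _ = _ := by
          rw [hC]
          field_simp
  -- The maximum of two consecutive values makes the second-order inequality first order: each step
  -- costs a factor `1 + C / b (n + 1)`, at most its exponential.
  set M : ℕ → ℝ := fun n => max (√(b n) * ‖u n‖) (√(b (n + 1)) * ‖u (n + 1)‖) with hM
  have hM0 : ∀ n, 0 ≤ M n := fun n => le_max_of_le_left (by positivity)
  have hstep : ∀ n, M (n + 1) ≤ Real.exp (C / b (n + 1)) * M n := fun n => by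
    have hp := hpos n
    have hx : 0 ≤ C / b (n + 1) := by positivity
    have h1 : √(b n) * ‖u n‖ ≤ M n := le_max_left _ _
    have h2 : √(b (n + 1)) * ‖u (n + 1)‖ ≤ M n := le_max_right _ _
    have h3 := mul_le_mul_of_nonneg_right (Real.add_one_le_exp (C / b (n + 1))) (hM0 n)
    refine le_trans (max_le ?_ ?_) h3
    · nlinarith [mul_nonneg hx (hM0 n)]
    · nlinarith [step n, mul_le_mul_of_nonneg_left h2 hx]
  have hbound : ∀ n, M n ≤ Real.exp (∑ k ∈ Finset.range n, C / b (k + 1)) * M 0 := fun n => by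
    induction n with
    | zero => simp
    | succ n ih =>
      rw [Finset.sum_range_succ, add_comm (Finset.sum _ _), Real.exp_add, mul_assoc]
      exact (hstep n).trans (mul_le_mul_of_nonneg_left ih (Real.exp_pos _).le)
  have hs : Summable fun k => C / b (k + 1) := by
    simpa [div_eq_mul_inv] using hsum.mul_left C
  refine ⟨Real.exp (∑' k, C / b (k + 1)) * M 0, fun n => ?_⟩
  refine (le_max_left _ _).trans ((hbound n).trans ?_)
  refine mul_le_mul_of_nonneg_right (Real.exp_le_exp.2 ?_) (hM0 0)
  exact hs.sum_le_tsum _ fun k _ => div_nonneg hC0 (hb _)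

theorem summable_norm_sq_of_recurrence {b : ℕ → ℝ} {u : ℕ → ℂ} {w : ℂ} {K : ℝ} (h0 : b 0 = 0)
    (hpos : ∀ n, 0 < b (n + 1)) (hlog : ∀ n, b n * b (n + 2) ≤ b (n + 1) ^ 2)
    (hK : ∀ n, b (n + 2) ≤ K * b (n + 1)) (hsum : Summable fun n => 1 / b (n + 1))
    (hu : ∀ n, (b n : ℂ) * u n + (b (n + 1) : ℂ) * u (n + 2) = w * u (n + 1)) :
    Summable fun n => ‖u (n + 1)‖ ^ 2 := by
  obtain ⟨B, hB⟩ := exists_sqrt_mul_norm_le h0 hpos hlog hK hsum hu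
  refine Summable.of_nonneg_of_le (fun n => by positivity) (fun n => ?_) (hsum.mul_left (B ^ 2))
  have hp := hpos n
  have h := pow_le_pow_left₀ (by positivity) (hB (n + 1)) 2
  rw [mul_pow, Real.sq_sqrt hp.le] at h
  rw [mul_one_div, le_div_iff₀' hp]
  exact h

/-! ### The Gribov weights and their polynomials. -/

theorem gribovWeight_zero : gribovWeight 0 = 0 := by simp [gribovWeight]

theorem gribovWeight_pos (n : ℕ) : 0 < gribovWeight (n + 1) := by
  unfold gribovWeight
  positivity

theorem gribovWeight_log_concave (n : ℕ) :
    gribovWeight n * gribovWeight (n + 2) ≤ gribovWeight (n + 1) ^ 2 := by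
  unfold gribovWeight
  push_cast
  -- From `(n + 1)(n + 3) ≤ (n + 2)²`.
  have h1 : √((n : ℝ) + 1) * √((n : ℝ) + 2 + 1) ≤ n + 1 + 1 := by
    rw [← Real.sqrt_mul (by positivity)]
    exact Real.sqrt_le_iff.2 ⟨by positivity, by nlinarith⟩
  have h2 : (n : ℝ) * (n + 2) ≤ (n + 1) ^ 2 := by nlinarith
  rw [mul_pow, Real.sq_sqrt (by positivity)]
  calc (n : ℝ) * √((n : ℝ) + 1) * ((n + 2) * √((n : ℝ) + 2 + 1))
      = n * (n + 2) * (√((n : ℝ) + 1) * √((n : ℝ) + 2 + 1)) := by ring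
    _ ≤ _ := by gcongr

/-- Any constant would serve; `4` comes from a factor `2` for `n + 2` against `n + 1` and a factor
`2` for the square roots. -/
theorem gribovWeight_succ_le (n : ℕ) : gribovWeight (n + 2) ≤ 4 * gribovWeight (n + 1) := by
  unfold gribovWeight
  push_cast
  have h1 : √((n : ℝ) + 2 + 1) ≤ 2 * √((n : ℝ) + 1 + 1) := by
    rw [Real.sqrt_le_iff]
    refine ⟨by positivity, ?_⟩
    rw [mul_pow, Real.sq_sqrt (by positivity)]
    linarith
  calc ((n : ℝ) + 2) * √((n : ℝ) + 2 + 1) ≤ (2 * (n + 1)) * (2 * √((n : ℝ) + 1 + 1)) := by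
        gcongr
        linarith
    _ = _ := by ring

/-- Comparison with the series of `n ^ (-3/2)`. -/
theorem summable_one_div_gribovWeight : Summable fun n : ℕ => 1 / gribovWeight (n + 1) := by
  have h : Summable fun n : ℕ => 1 / (((n + 1 : ℕ) : ℝ) ^ (3 / 2 : ℝ)) :=
    (summable_nat_add_iff 1).2 (Real.summable_one_div_nat_rpow.2 (by norm_num))
  refine Summable.of_nonneg_of_le (fun n => (one_div_pos.2 (gribovWeight_pos n)).le) (fun n => ?_) h
  have hp : (0 : ℝ) < ((n + 1 : ℕ) : ℝ) := by positivity
  refine one_div_le_one_div_of_le (by positivity) ?_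
  rw [show (3 / 2 : ℝ) = 1 + 1 / 2 by norm_num, Real.rpow_add hp, Real.rpow_one,
    ← Real.sqrt_eq_rpow, gribovWeight]
  gcongr
  linarith

/-- The polynomials of the first kind of the Jacobi–Gribov matrix. -/
abbrev gribovPolynomial : ℕ → ℂ[X] := firstKind (fun _ => 0) gribovWeight

theorem gribovPolynomial_recurrence (n : ℕ) :
    C (gribovWeight n : ℂ) * gribovPolynomial n +
      C (gribovWeight (n + 1) : ℂ) * gribovPolynomial (n + 2) = X * gribovPolynomial (n + 1) := by
  have h : (C (gribovWeight (n + 1) : ℂ) : ℂ[X]) * C ((gribovWeight (n + 1) : ℂ)⁻¹) = 1 := by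
    rw [← C_mul, mul_inv_cancel₀ (by exact_mod_cast (gribovWeight_pos n).ne'), C_1]
  rcases n with _ | n
  · simp only [gribovPolynomial, firstKind, ← mul_assoc, h]
    simp
  · simp only [gribovPolynomial, firstKind, ← mul_assoc, h]
    simp

theorem isCanonicalSystem_gribovPolynomial : IsCanonicalSystem gribovWeight gribovPolynomial where
  zero := gribovWeight_zero
  pos n hn := by
    obtain ⟨n, rfl⟩ := Nat.exists_eq_add_of_le' hn
    exact gribovWeight_pos n
  one := rfl
  recurrence n hn := by
    obtain ⟨n, rfl⟩ := Nat.exists_eq_add_of_le' hn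
    exact gribovPolynomial_recurrence n

theorem exists_map_eq_firstKind (a b : ℕ → ℝ) :
    ∀ n, ∃ p : ℝ[X], p.map Complex.ofRealHom = firstKind a b n
  | 0 => ⟨0, by simp [firstKind]⟩
  | 1 => ⟨1, by simp [firstKind]⟩
  | 2 => ⟨C (b 1)⁻¹ * (X - C (a 1)), by simp [firstKind]⟩
  | n + 3 => by
    obtain ⟨p, hp⟩ := exists_map_eq_firstKind a b (n + 2)
    obtain ⟨q, hq⟩ := exists_map_eq_firstKind a b (n + 1)
    exact ⟨C (b (n + 2))⁻¹ * ((X - C (a (n + 2))) * p - C (b (n + 1)) * q), by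
      simp [firstKind, hp, hq]⟩

theorem eval_neg_firstKind (b : ℕ → ℝ) (x : ℂ) : ∀ n,
    (firstKind (fun _ => 0) b (n + 1)).eval (-x) =
      (-1) ^ n * (firstKind (fun _ => 0) b (n + 1)).eval x
  | 0 => by simp [firstKind]
  | 1 => by simp [firstKind]
  | n + 2 => by
    have h1 := eval_neg_firstKind b x (n + 1)
    have h2 := eval_neg_firstKind b x n
    simp [firstKind, h1, h2]
    ring

theorem eval_recurrence (w : ℂ) (n : ℕ) :
    (gribovWeight n : ℂ) * (gribovPolynomial n).eval w +
      (gribovWeight (n + 1) : ℂ) * (gribovPolynomial (n + 2)).eval w =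
        w * (gribovPolynomial (n + 1)).eval w := by
  have h := congrArg (Polynomial.eval w) (gribovPolynomial_recurrence n)
  simpa only [eval_add, eval_mul, eval_C, eval_X] using h

/-- Because `b 0 = 0`, the first equation already determines `a 1` from `a 0`, so the solution space
is at most one-dimensional. This gives the upper bound on the deficiency. -/
theorem eq_mul_eval_of_recurrence {a : ℕ → ℂ} {w : ℂ}
    (ha : ∀ n, (gribovWeight n : ℂ) * a (n - 1) + (gribovWeight (n + 1) : ℂ) * a (n + 1) = w * a n)
    (n : ℕ) : a n = a 0 * (gribovPolynomial (n + 1)).eval w := by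
  induction n using Nat.strong_induction_on with
  | _ n ih =>
    rcases n with _ | n
    · simp [gribovPolynomial, firstKind]
    · have hb : (gribovWeight (n + 1) : ℂ) ≠ 0 := by exact_mod_cast (gribovWeight_pos n).ne'
      have h1 := ha n
      have h2 := eval_recurrence w n
      have h3 := ih n n.lt_succ_self
      have h4 : (gribovWeight n : ℂ) * a (n - 1) =
          gribovWeight n * (a 0 * (gribovPolynomial n).eval w) := by
        rcases n with _ | n
        · simp [gribovWeight_zero]
        · rw [Nat.add_sub_cancel, ih n (by omega)]
      refine mul_left_cancel₀ hb ?_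
      rw [h4, h3] at h1
      linear_combination h1 - a 0 * h2

/-! ### Adjoint relations on a span and on a closure. -/

section LinearPMap

variable {E : Type*} [NormedAddCommGroup E] [InnerProductSpace ℂ E]

theorem inner_eq_of_domain_eq_span {ι : Type*} {T : E →ₗ.[ℂ] E} {v : ι → E}
    (hT : T.domain = Submodule.span ℂ (Set.range v)) (hv : ∀ i, v i ∈ T.domain) {φ ψ : E}
    (h : ∀ i, inner ℂ φ (T ⟨v i, hv i⟩) = inner ℂ ψ (v i)) (x : T.domain) :
    inner ℂ φ (T x) = inner ℂ ψ (x : E) := by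
  obtain ⟨x, hx⟩ := x
  have hx' := hx
  rw [hT] at hx'
  induction hx' using Submodule.span_induction with
  | mem x hxv =>
    obtain ⟨i, rfl⟩ := hxv
    exact h i
  | zero =>
    rw [show (⟨0, hx⟩ : T.domain) = 0 from rfl, LinearPMap.map_zero, ZeroMemClass.coe_zero,
      inner_zero_right, inner_zero_right]
  | add x y hx1 hy1 ihx ihy =>
    rw [← hT] at hx1 hy1
    have := T.map_add ⟨x, hx1⟩ ⟨y, hy1⟩
    rw [show (⟨x + y, hx⟩ : T.domain) = ⟨x, hx1⟩ + ⟨y, hy1⟩ from rfl, this, Submodule.coe_add,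
      inner_add_right, inner_add_right, ihx, ihy]
  | smul c x hx1 ihx =>
    rw [← hT] at hx1
    rw [show (⟨c • x, hx⟩ : T.domain) = c • ⟨x, hx1⟩ from rfl, LinearPMap.map_smul,
      Submodule.coe_smul, inner_smul_right, inner_smul_right, ihx]

/-- For fixed `φ` and `ψ` the relation is a closed condition on graph points, so passing to the
closure leaves the adjoint unchanged. -/
theorem inner_eq_of_graph_le_closure {S T : E →ₗ.[ℂ] E}
    (hS : S.graph ≤ T.graph.topologicalClosure) {φ ψ : E}
    (h : ∀ x : T.domain, inner ℂ φ (T x) = inner ℂ ψ (x : E)) (x : S.domain) :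
    inner ℂ φ (S x) = inner ℂ ψ (x : E) := by
  have hc : IsClosed {p : E × E | inner ℂ φ p.2 = inner ℂ ψ p.1} :=
    isClosed_eq (by fun_prop) (by fun_prop)
  refine closure_minimal ?_ hc (hS (S.mem_graph x))
  rintro ⟨y, y'⟩ hy
  obtain ⟨z, rfl, rfl⟩ := (T.mem_graph_iff).1 hy
  exact h z

/-- Symmetry extends to the closure one variable at a time. -/
theorem isFormalAdjoint_self_of_graph_le_closure {S T : E →ₗ.[ℂ] E}
    (hS : S.graph ≤ T.graph.topologicalClosure) (hT : T.IsFormalAdjoint T) :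
    S.IsFormalAdjoint S := fun x y => by
  refine (inner_eq_of_graph_le_closure hS (fun z => ?_) y).symm
  have h := inner_eq_of_graph_le_closure hS (φ := (z : E)) (ψ := T z) (fun t => (hT z t).symm) x
  rw [← inner_conj_symm, ← h, inner_conj_symm]

theorem smul_le_smul {f g : E →ₗ.[ℂ] E} (h : f ≤ g) (c : ℂ) : c • f ≤ c • g :=
  ⟨h.1, fun x y hxy => by
    rw [LinearPMap.smul_apply, LinearPMap.smul_apply]
    exact congrArg (c • ·) (h.2 (x := x) (y := y) hxy)⟩

/-- Together with `smul_le_smul`, this treats a multiple of the minimal operator without identifying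
it as the closure of the multiple. -/
theorem graph_smul_le_topologicalClosure {S T : E →ₗ.[ℂ] E}
    (hS : S.graph ≤ T.graph.topologicalClosure) (c : ℂ) :
    (c • S).graph ≤ (c • T).graph.topologicalClosure := by
  rw [LinearPMap.smul_graph, LinearPMap.smul_graph]
  rintro _ ⟨p, hp, rfl⟩
  refine map_mem_closure (f := fun p : E × E => (p.1, c • p.2)) (by fun_prop) (hS hp) fun q hq => ?_
  exact ⟨q, hq, rfl⟩

theorem IsFormalAdjoint.smul {S T : E →ₗ.[ℂ] E} (h : T.IsFormalAdjoint S) (c : ℂ) :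
    (c • T).IsFormalAdjoint (conj c • S) := fun x y => by
  rw [LinearPMap.smul_apply, LinearPMap.smul_apply, inner_smul_left, inner_smul_right, h x y]

/-! ### The abstract Jacobi–Gribov operator and its deficiency spaces. -/

/-- `J` is the operator of the Jacobi–Gribov matrix in the basis `e`, on the span of `e`. -/
structure IsJacobiGribov (e : HilbertBasis ℕ ℂ E) (J : E →ₗ.[ℂ] E) : Prop where
  domain_eq : J.domain = Submodule.span ℂ (Set.range e)
  mem_domain : ∀ n, e n ∈ J.domain
  apply_basis : ∀ n, J ⟨e n, mem_domain n⟩ =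
    (gribovWeight n : ℂ) • e (n - 1) + (gribovWeight (n + 1) : ℂ) • e (n + 1)

variable {e : HilbertBasis ℕ ℂ E} {J : E →ₗ.[ℂ] E}

theorem IsJacobiGribov.dense_domain (hJ : IsJacobiGribov e J) : Dense (J.domain : Set E) := by
  rw [hJ.domain_eq, Submodule.dense_iff_topologicalClosure_eq_top]
  exact e.dense_span

theorem IsJacobiGribov.isFormalAdjoint (hJ : IsJacobiGribov e J) : J.IsFormalAdjoint J := by
  have hd : J.domain = Submodule.span ℂ (Set.range e) := hJ.domain_eq
  have h0 : ∀ i j, inner ℂ (e i) (J ⟨e j, hJ.mem_domain j⟩) =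
      inner ℂ (J ⟨e i, hJ.mem_domain i⟩) (e j) := fun i j => by
    have ho := orthonormal_iff_ite.1 e.orthonormal
    simp only [hJ.apply_basis, inner_add_left, inner_add_right, inner_smul_left, inner_smul_right,
      ho, Complex.conj_ofReal]
    -- Truncated subtraction makes index `0` special; its spurious term carries weight `0`.
    rcases i with _ | i <;> rcases j with _ | j
    · simp [gribovWeight_zero]
    · rcases j with _ | j <;> simp [gribovWeight_zero]
    · rcases i with _ | i <;> simp [gribovWeight_zero]
    · by_cases h1 : i + 1 = j
      · subst h1; simp [show i ≠ i + 1 + 1 by omega]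
      · by_cases h2 : j + 1 = i
        · subst h2; simp [h1]
        · simp [h1, Ne.symm h2]
  have h1 := fun i => inner_eq_of_domain_eq_span hd hJ.mem_domain (h0 i)
  intro y x
  refine (inner_eq_of_domain_eq_span hd hJ.mem_domain (fun i => ?_) x).symm
  rw [← inner_conj_symm, ← h1 i y, inner_conj_symm]

/-- `c • J` lies below the adjoint of the densely defined `conj c • J`, which is closed. -/
theorem IsJacobiGribov.isClosable_smul [CompleteSpace E] (hJ : IsJacobiGribov e J) (c : ℂ) : (c • J).IsClosable := by
  have h := IsFormalAdjoint.smul hJ.isFormalAdjoint (conj c)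
  rw [Complex.conj_conj] at h
  have hd : Dense ((conj c • J).domain : Set E) := hJ.dense_domain
  exact (LinearPMap.adjoint_isClosed hd).isClosable.leIsClosable (h.le_adjoint hd)

/-- The eigenvector of the adjoint Jacobi–Gribov operator with coefficients `P (n + 1) w`. -/
def eigenvector (e : HilbertBasis ℕ ℂ E) (w : ℂ) : E :=
  e.repr.symm ⟨fun n => (gribovPolynomial (n + 1)).eval w, by
    refine memℓp_gen ?_
    simpa using summable_norm_sq_of_recurrence (u := fun n => (gribovPolynomial n).eval w)
      gribovWeight_zero gribovWeight_pos gribovWeight_log_concave gribovWeight_succ_le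
      summable_one_div_gribovWeight (eval_recurrence w)⟩

theorem inner_basis_eigenvector (e : HilbertBasis ℕ ℂ E) (w : ℂ) (n : ℕ) :
    inner ℂ (e n) (eigenvector e w) = (gribovPolynomial (n + 1)).eval w := by
  rw [← HilbertBasis.repr_apply_apply, eigenvector,
    LinearIsometryEquiv.apply_symm_apply]

/-- Conjugating the adjoint relation at `e n` yields the recurrence for the coefficients of `φ`, as
the weights are real. -/
theorem IsJacobiGribov.inner_smul_apply_eq_iff (hJ : IsJacobiGribov e J) {c : ℂ} (hc : c ≠ 0) (μ : ℂ) (φ : E) (n : ℕ) :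
    inner ℂ φ (c • J ⟨e n, hJ.mem_domain n⟩) = inner ℂ (μ • φ) (e n) ↔
      (gribovWeight n : ℂ) * inner ℂ (e (n - 1)) φ +
        (gribovWeight (n + 1) : ℂ) * inner ℂ (e (n + 1)) φ =
          μ / conj c * inner ℂ (e n) φ := by
  have hc' : conj c ≠ 0 := (_root_.map_ne_zero _).2 hc
  rw [← (starRingEnd ℂ).injective.eq_iff, inner_conj_symm, inner_conj_symm, inner_smul_left,
    inner_smul_right, hJ.apply_basis, inner_add_left, inner_smul_left, inner_smul_left,
    Complex.conj_ofReal, Complex.conj_ofReal, div_mul_eq_mul_div, eq_div_iff hc', mul_comm]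

/-- Existence comes from the square-summable eigenvector, uniqueness from the recurrence. Allowing
every `μ` covers both half-planes at once. -/
theorem IsJacobiGribov.rank_ker_adjoint_sub_smul [CompleteSpace E] (hJ : IsJacobiGribov e J) {S : E →ₗ.[ℂ] E} {c : ℂ} (hc : c ≠ 0)
    (h1 : c • J ≤ S) (h2 : S.graph ≤ (c • J).graph.topologicalClosure) (μ : ℂ) :
    Module.rank ℂ (LinearMap.ker (S.adjoint.toFun - μ • S.adjoint.domain.subtype)) = 1 := by
  have hd : Dense (S.domain : Set E) := hJ.dense_domain.mono h1.1
  have hspan : (c • J).domain = Submodule.span ℂ (Set.range e) := hJ.domain_eq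
  set w := μ / conj c
  have hv : ∀ x : S.domain, inner ℂ (μ • eigenvector e w) (x : E) =
      inner ℂ (eigenvector e w) (S x) := fun x => by
    refine (inner_eq_of_graph_le_closure h2 (fun y => ?_) x).symm
    refine inner_eq_of_domain_eq_span hspan hJ.mem_domain (fun n => ?_) y
    refine (hJ.inner_smul_apply_eq_iff hc μ _ n).2 ?_
    simp only [inner_basis_eigenvector]
    -- At `n = 0` the truncated index gives `P 1` where the recurrence has `P 0`; both carry weight
    -- `0`.
    rcases n with _ | n
    · have := eval_recurrence w 0
      simp only [gribovWeight_zero, Complex.ofReal_zero, zero_mul] at this ⊢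
      exact this
    · exact eval_recurrence w (n + 1)
  have hmem : eigenvector e w ∈ S.adjoint.domain :=
    LinearPMap.mem_adjoint_domain_of_exists _ ⟨_, hv⟩
  have hker : (⟨eigenvector e w, hmem⟩ : S.adjoint.domain) ∈
      LinearMap.ker (S.adjoint.toFun - μ • S.adjoint.domain.subtype) := by
    rw [LinearMap.mem_ker, LinearMap.sub_apply, sub_eq_zero]
    exact LinearPMap.adjoint_apply_eq hd _ hv
  -- The first coefficient is `P 1 = 1`, so the eigenvector is nonzero.
  have hone : inner ℂ (e 0) (eigenvector e w) = 1 := by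
    rw [inner_basis_eigenvector]
    simp [gribovPolynomial, firstKind]
  refine rank_eq_one ⟨_, hker⟩ (fun h => ?_) fun φ => ?_
  · have h3 : eigenvector e w = 0 := congrArg (fun x => ((x.1 : S.adjoint.domain) : E)) h
    rw [h3, inner_zero_right] at hone
    exact zero_ne_one hone
  · obtain ⟨⟨φ, hφ⟩, hφk⟩ := φ
    refine ⟨inner ℂ (e 0) φ, Subtype.ext (Subtype.ext ?_)⟩
    rw [LinearMap.mem_ker, LinearMap.sub_apply, sub_eq_zero] at hφk
    have h3 : ∀ n, inner ℂ φ (c • J ⟨e n, hJ.mem_domain n⟩) =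
        inner ℂ (μ • φ) (e n) := fun n => by
      have h4 := LinearPMap.adjoint_isFormalAdjoint hd ⟨φ, hφ⟩
        ⟨e n, h1.1 (hJ.mem_domain n)⟩
      have h5 : S.adjoint ⟨φ, hφ⟩ = μ • φ := hφk
      rw [h5] at h4
      rw [h4]
      exact congrArg _ (h1.2 (x := ⟨e n, hJ.mem_domain n⟩) rfl)
    have h6 := eq_mul_eval_of_recurrence (a := fun n => inner ℂ (e n) φ)
      fun n => (hJ.inner_smul_apply_eq_iff hc μ φ n).1 (h3 n)
    change inner ℂ (e 0) φ • eigenvector e w = φ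
    refine e.repr.injective (lp.ext (funext fun n => ?_))
    rw [HilbertBasis.repr_apply_apply, HilbertBasis.repr_apply_apply,
      inner_smul_right, inner_basis_eigenvector]
    exact (h6 n).symm

theorem IsJacobiGribov.hasDeficiencyIndices [CompleteSpace E] (hJ : IsJacobiGribov e J) {S : E →ₗ.[ℂ] E} {c : ℂ} (hc : c ≠ 0)
    (h1 : c • J ≤ S) (h2 : S.graph ≤ (c • J).graph.topologicalClosure) :
    HasDeficiencyIndices S 1 1 :=
  ⟨fun z _ => by rw [hJ.rank_ker_adjoint_sub_smul hc h1 h2, Nat.cast_one],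
    fun z _ => by rw [hJ.rank_ker_adjoint_sub_smul hc h1 h2, Nat.cast_one]⟩

end LinearPMap

/-! ### Application to the Bargmann space. -/

theorem isJacobiGribov_heunOp : IsJacobiGribov monomialBasis heunOp := by
  have h : (monomialBasis : ℕ → bargmannZero) = basisFn := funext monomialBasis_apply
  refine ⟨?_, fun n => ?_, fun n => ?_⟩
  · rw [h]
    exact polynomialsZero_eq_span
  · rw [h]
    exact basisFn_mem_domain n
  · simp only [h]
    exact heunOp_basisFn n

theorem neg_I_smul_gribovOp (lam : ℝ) : (-Complex.I) • gribovOp lam = (lam : ℂ) • heunOp := by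
  rw [gribovOp, smul_smul]
  congr 1
  rw [← mul_assoc, neg_mul, Complex.I_mul_I, neg_neg, one_mul]

end Gribov
end

theorem mainTheorem4 :
    -- (i) the polynomials of the first kind are the canonical system of the weights `b`
    Gribov.IsCanonicalSystem Gribov.gribovWeight
      (Gribov.firstKind (fun _ => 0) Gribov.gribovWeight) ∧
    -- (ii) real coefficients and parity
    (∀ n k : ℕ, 1 ≤ n →
      ((Gribov.firstKind (fun _ => 0) Gribov.gribovWeight n).coeff k).im = 0) ∧
    (∀ n : ℕ, 1 ≤ n → ∀ x : ℂ,
      (Gribov.firstKind (fun _ => 0) Gribov.gribovWeight n).eval (-x) =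
        (-1) ^ (n - 1) * (Gribov.firstKind (fun _ => 0) Gribov.gribovWeight n).eval x) ∧
    -- (iii)
    (∀ n : ℕ, 1 ≤ n → Gribov.gribovWeight (n - 1) * Gribov.gribovWeight (n + 1) ≤
      Gribov.gribovWeight n ^ 2) ∧
    -- (iv)
    Summable (fun n : ℕ => 1 / Gribov.gribovWeight (n + 1)) ∧
    -- (v)
    (∀ lam : ℝ, lam ≠ 0 →
      Dense ((Gribov.gribovOp lam).domain : Set Gribov.bargmannZero) ∧
      (Gribov.gribovOp lam).IsClosable ∧
      Gribov.HasDeficiencyIndices (Gribov.gribovMin lam) 1 1 ∧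
      ((-Complex.I) • Gribov.gribovMin lam).IsFormalAdjoint
        ((-Complex.I) • Gribov.gribovMin lam) ∧
      Gribov.HasDeficiencyIndices ((-Complex.I) • Gribov.gribovMin lam) 1 1) := by
  refine ⟨Gribov.isCanonicalSystem_gribovPolynomial, fun n k _ => ?_, fun n hn x => ?_,
    fun n hn => ?_, Gribov.summable_one_div_gribovWeight, fun lam hlam => ?_⟩
  · obtain ⟨p, hp⟩ := Gribov.exists_map_eq_firstKind (fun _ => 0) Gribov.gribovWeight n
    rw [← hp, Polynomial.coeff_map]
    exact Complex.ofReal_im _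
  · obtain ⟨n, rfl⟩ := Nat.exists_eq_add_of_le' hn
    exact Gribov.eval_neg_firstKind _ x n
  · obtain ⟨n, rfl⟩ := Nat.exists_eq_add_of_le' hn
    exact Gribov.gribovWeight_log_concave n
  · have hlam' : (lam : ℂ) ≠ 0 := by exact_mod_cast hlam
    have hcl : (Gribov.gribovOp lam).IsClosable := Gribov.isJacobiGribov_heunOp.isClosable_smul _
    have hgr : (Gribov.gribovMin lam).graph ≤ (Gribov.gribovOp lam).graph.topologicalClosure :=
      hcl.graph_closure_eq_closure_graph.ge
    have hle : Gribov.gribovOp lam ≤ Gribov.gribovMin lam := LinearPMap.le_closure _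
    -- Multiplication by `-i` turns `iλ` into the real factor `λ`, for which symmetry of `heunOp`
    -- survives.
    have hgr' := Gribov.graph_smul_le_topologicalClosure hgr (-Complex.I)
    have hle' := Gribov.smul_le_smul hle (-Complex.I)
    rw [Gribov.neg_I_smul_gribovOp] at hgr' hle'
    have hsymm := Gribov.IsFormalAdjoint.smul Gribov.isJacobiGribov_heunOp.isFormalAdjoint (lam : ℂ)
    rw [Complex.conj_ofReal] at hsymm
    exact ⟨Gribov.isJacobiGribov_heunOp.dense_domain, hcl,
      Gribov.isJacobiGribov_heunOp.hasDeficiencyIndices (mul_ne_zero Complex.I_ne_zero hlam') hle hgr,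
      Gribov.isFormalAdjoint_self_of_graph_le_closure hgr' hsymm,
      Gribov.isJacobiGribov_heunOp.hasDeficiencyIndices hlam' hle' hgr'⟩
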